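/- Conventions. For a real symmetric matrix $M$, $\rho(M)$ and $\rho_{\min}(M)$ denote its largest and smallest eigenvalue, and $\mathrm{Cond}(M)=\rho(M)/\rho_{\min}(M)$ if $M$ is positive definite; $|||\cdot|||$ is the operator norm with respect to the Euclidean norm on $\mathbb R^n$. For $H\in\mathbb R^{n\times K}$, $P_{[H]}$ is the orthogonal projection of $\mathbb R^n$ onto the span $[H]$ of the columns of $H$, and for $\alpha\ge 0$ the ridge-regularized projection is $P_{[H]_\alpha}=H(H^TH+\alpha I_K)^{-1}H^T$. Setting (Scenario 3, independent columns). Let $1\le K\le n$, let $H\in\mathbb R^{n\times K}$ have full rank $K$, let $\gamma\in\mathbb R$, let $A\in\mathbb R^{n\times n}$ be symmetric positive semidefinite, and let $\hat H=H+E$, where $E$ is a random $n\times K$ matrix whose columns are independent with $E_{\cdot,j}\sim\mathcal N_n(0,\gamma^2A)$ for $j=1,\dots,K$. Theorem. Let $\delta\in(0,1)$ and let $d_\delta>0$ be any constant depending only on $\delta$. There is a constant $D_\delta>0$, depending only on $\delta$ and on the choice of $d_\delta$, such that in the above setting, for all $n,K,H,\gamma,A$ and with $$\alpha=2d_\delta\,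 n\,\gamma^2\rho(A),$$ no lower bound on $\rho_{\min}(H^TH)$ being assumed, the following holds with probability at least $1-\delta$: $$\frac1n|||P_{[H]}-P_{[\hat H]_\alpha}|||^2\le \gamma^2D_\delta\max\left(\mathrm{Cond}(H^TH)^3\frac{K\rho(A)}{n\rho_{\min}(H^TH)},\ \mathrm{Cond}(H^TH)^3\frac{\mathrm{Tr}(A)}{n\rho_{\min}(H^TH)},\ \frac{\rho(A)}{\rho_{\min}(H^TH)}\right),$$ and consequently (corollary), on the same event, for every $C\ge1$ with $n\rho(A)\le C\max(K\rho(A),\mathrm{Tr}(A))$, $$\frac1n|||P_{[H]}-P_{[\hat H]_\alpha}|||^2\le C\,\gamma^2D_\delta\,\mathrm{Cond}(H^TH)^3\max\left(\frac Kn\,\frac{\rho(A)}{\rho_{\min}(H^TH)},\ \frac{\mathrm{Tr}(A)}{n\rho_{\min}(H^TH)}\right).$$ -/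

import Mathlib

open MeasureTheory ProbabilityTheory
open scoped Matrix

noncomputable section

namespace NoisyProjection

/-- `ρ(M)`: the largest eigenvalue of a real symmetric matrix. -/
def rhoMax {m : ℕ} (M : Matrix (Fin m) (Fin m) ℝ) : ℝ := sSup (spectrum ℝ M)

/-- `ρ_min(M)`: the smallest eigenvalue of a real symmetric matrix. -/
def rhoMin {m : ℕ} (M : Matrix (Fin m) (Fin m) ℝ) : ℝ := sInf (spectrum ℝ M)

/-- `Cond(M)`: the condition number of a positive definite matrix. -/
def cond {m : ℕ} (M : Matrix (Fin m) (Fin m) ℝ) : ℝ := rhoMax M / rhoMin M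

/-- `[H]`: the subspace of `ℝⁿ` (with its Euclidean structure) spanned by the columns of `H`. -/
def colSpan {n K : ℕ} (H : Matrix (Fin n) (Fin K) ℝ) : Submodule ℝ (EuclideanSpace ℝ (Fin n)) :=
  Submodule.span ℝ (Set.range fun j : Fin K => WithLp.toLp 2 (H.col j))

/-- `P_{[H]}`: the orthogonal projection of `ℝⁿ` onto `[H]`. -/
def proj {n K : ℕ} (H : Matrix (Fin n) (Fin K) ℝ) :
    EuclideanSpace ℝ (Fin n) →L[ℝ] EuclideanSpace ℝ (Fin n) :=
  (colSpan H).starProjection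

/-- `P_{[H]_α} = H (Hᵀ H + α I)⁻¹ Hᵀ`: the ridge-regularized projection operator. -/
def ridgeProj {n K : ℕ} (α : ℝ) (H : Matrix (Fin n) (Fin K) ℝ) :
    EuclideanSpace ℝ (Fin n) →L[ℝ] EuclideanSpace ℝ (Fin n) :=
  Matrix.toEuclideanCLM (𝕜 := ℝ) (H * (Hᵀ * H + α • (1 : Matrix (Fin K) (Fin K) ℝ))⁻¹ * Hᵀ)

/-- The `j`-th column of the random matrix `E`, as a random vector of `ℝⁿ`. -/
def noiseCol {Ω : Type*} {n K : ℕ} (E : Ω → Matrix (Fin n) (Fin K) ℝ) (j : Fin K) :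
    Ω → EuclideanSpace ℝ (Fin n) :=
  fun ω => WithLp.toLp 2 ((E ω).col j)

/-- Independent columns: the columns of the noise `E` are independent and each of them
has the law `𝒩ₙ(0, γ² A)`, with `A` a covariance (symmetric positive semidefinite) matrix. -/
structure IndependentColumns {Ω : Type*} [MeasurableSpace Ω] (P : Measure Ω) {n K : ℕ}
    (E : Ω → Matrix (Fin n) (Fin K) ℝ) (γ : ℝ) (A : Matrix (Fin n) (Fin n) ℝ) : Prop where
  posSemidef : A.PosSemidef
  law : ∀ j, HasLaw (noiseCol E j) (multivariateGaussian 0 (γ ^ 2 • A)) P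
  indep : iIndepFun (noiseCol E) P

end NoisyProjection

end

/-! The last term of the maximum already bounds the error: with `s = n γ² ρ(A)` and `r =
ρ_min(HᵀH)`, the squared distance is at most `D * (s / r)`. The other terms and the powers of the
condition number, which is at least 1, only weaken this.

Noise: every form ⟨y, E x⟩ is sub-Gaussian, so a union bound over nets gives ‖E‖² ≤ L s with
probability at least 1 - δ (`measure_opNorm_sq_le`).

Given this event, the rest is deterministic (`norm_proj_sub_ridgeProj_sq_le`). If r < 4 L s, the
trivial bound 2 on the distance suffices. Otherwise ‖E‖ ≤ √r / 2, so H + E is bounded below by √r /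
2, and `norm_starProjection_sub_ridge_le` bounds the distance by a ridge bias of order α / r plus a
term of order ‖E‖ / √r. After squaring, the bias gives (s / r)², which is linear in s / r up to a
constant because s / r ≤ 1 / (4 L). -/

namespace NoisyProjection

/-! ### Perturbation of projections by ridge fits. -/

section Perturbation

open scoped RealInnerProductSpace

variable {V W : Type*} [NormedAddCommGroup V] [InnerProductSpace ℝ V]
  [NormedAddCommGroup W] [InnerProductSpace ℝ W]

/-- The ridge fit `S (R y)` does not expand norms when `R` solves the ridge normal equations. -/
lemma norm_ridge_apply_le {S : V →L[ℝ] W} {R : W →L[ℝ] V} {α : ℝ} (hα : 0 ≤ α)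
    (hR : ∀ y v, ⟪S (R y), S v⟫ + α * ⟪R y, v⟫ = ⟪y, S v⟫) (y : W) : ‖S (R y)‖ ≤ ‖y‖ := by
  have h := hR y (R y)
  rw [real_inner_self_eq_norm_sq, real_inner_self_eq_norm_sq] at h
  have h1 := real_inner_le_norm y (S (R y))
  have h2 : 0 ≤ α * ‖R y‖ ^ 2 := by positivity
  by_contra! hlt
  nlinarith [norm_nonneg y]

/-- The ridge fit is a self-adjoint operation. -/
lemma inner_ridge_apply_comm {S : V →L[ℝ] W} {R : W →L[ℝ] V} {α : ℝ}
    (hR : ∀ y v, ⟪S (R y), S v⟫ + α * ⟪R y, v⟫ = ⟪y, S v⟫) (y z : W) :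
    ⟪S (R y), z⟫ = ⟪y, S (R z)⟫ := by
  rw [real_inner_comm, ← hR z (R y), ← hR y (R z), real_inner_comm, real_inner_comm (R y)]

/-- The bias of the ridge fit on the range of `S`. -/
lemma norm_sub_ridge_apply_le {S : V →L[ℝ] W} {R : W →L[ℝ] V} {α τ : ℝ} (hα : 0 ≤ α)
    (hτ : 0 < τ) (hS : ∀ v, τ * ‖v‖ ≤ ‖S v‖)
    (hR : ∀ y v, ⟪S (R y), S v⟫ + α * ⟪R y, v⟫ = ⟪y, S v⟫) (x : V) :
    ‖S x - S (R (S x))‖ ≤ α / τ ^ 2 * ‖S x‖ := by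
  set w := R (S x) with hw
  -- The normal equations for `S x`, tested against the residual `x - w`.
  have h1 : ‖S (x - w)‖ ^ 2 = α * ⟪w, x - w⟫ := by
    have := hR (S x) (x - w)
    rw [← real_inner_self_eq_norm_sq]
    nth_rewrite 1 [map_sub]
    rw [inner_sub_left]
    linarith
  have h2 := real_inner_le_norm w (x - w)
  have h3 := hS w
  have h4 := hS (x - w)
  have h5 : ‖S w‖ ≤ ‖S x‖ := norm_ridge_apply_le hα hR _
  rw [← map_sub]
  rw [div_mul_eq_mul_div, le_div_iff₀ (by positivity)]
  have h6 : τ ^ 2 * (‖w‖ * ‖x - w‖) ≤ ‖S x‖ * ‖S (x - w)‖ := by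
    calc τ ^ 2 * (‖w‖ * ‖x - w‖) = (τ * ‖w‖) * (τ * ‖x - w‖) := by ring
      _ ≤ ‖S x‖ * ‖S (x - w)‖ := by gcongr; exact h3.trans h5
  have h7 : τ ^ 2 * ‖S (x - w)‖ ^ 2 ≤ α * (‖S x‖ * ‖S (x - w)‖) := by
    rw [h1]
    calc τ ^ 2 * (α * ⟪w, x - w⟫) ≤ τ ^ 2 * (α * (‖w‖ * ‖x - w‖)) := by gcongr
      _ = α * (τ ^ 2 * (‖w‖ * ‖x - w‖)) := by ring
      _ ≤ _ := by gcongr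
  rcases (norm_nonneg (S (x - w))).eq_or_lt with h0 | h0
  · rw [← h0]; simp; positivity
  · nlinarith

/-- The ridge fit is at distance at most two from an orthogonal projection. -/
lemma norm_starProjection_sub_ridge_le_two (U : Submodule ℝ W) [U.HasOrthogonalProjection]
    {S : V →L[ℝ] W} {R : W →L[ℝ] V} {α : ℝ} (hα : 0 ≤ α)
    (hR : ∀ y v, ⟪S (R y), S v⟫ + α * ⟪R y, v⟫ = ⟪y, S v⟫) :
    ‖U.starProjection - S ∘L R‖ ≤ 2 := by
  have h1 : ‖S ∘L R‖ ≤ 1 := ContinuousLinearMap.opNorm_le_bound _ zero_le_one fun y => by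
    simpa using norm_ridge_apply_le hα hR y
  linarith [norm_sub_le U.starProjection (S ∘L R), U.starProjection_norm_le]

/-- Perturbation bound: if `T` is bounded below by `σ` and `‖F‖ ≤ σ / 2`, the ridge fit of
`T + F` is close to the orthogonal projection onto the range of `T`. -/
lemma norm_starProjection_sub_ridge_le [CompleteSpace W]
    (U : Submodule ℝ W) [U.HasOrthogonalProjection]
    {T F : V →L[ℝ] W} {R : W →L[ℝ] V} {α σ : ℝ} (hα : 0 ≤ α) (hσ : 0 < σ)
    (hU : U = T.range) (hT : ∀ v, σ * ‖v‖ ≤ ‖T v‖) (hF : ‖F‖ ≤ σ / 2)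
    (hR : ∀ y v, ⟪(T + F) (R y), (T + F) v⟫ + α * ⟪R y, v⟫ = ⟪y, (T + F) v⟫) :
    ‖U.starProjection - (T + F) ∘L R‖ ≤ 6 * α / σ ^ 2 + 4 * ‖F‖ / σ := by
  set S := T + F with hSdef
  have hS : ∀ v, σ / 2 * ‖v‖ ≤ ‖S v‖ := fun v => by
    have h1 : ‖T v‖ ≤ ‖S v‖ + ‖F v‖ := by
      have : T v = S v - F v := by simp [hSdef]
      rw [this]; exact norm_sub_le _ _
    have h2 : ‖F v‖ ≤ σ / 2 * ‖v‖ := F.le_of_opNorm_le hF v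
    linarith [hT v]
  set P := U.starProjection with hP
  set Q := S ∘L R with hQ
  have hQle : ∀ y, ‖Q y‖ ≤ ‖y‖ := fun y => norm_ridge_apply_le hα hR y
  have hPsa : IsSelfAdjoint P := isSelfAdjoint_starProjection U
  have hQsa : IsSelfAdjoint Q := by
    rw [ContinuousLinearMap.isSelfAdjoint_iff_isSymmetric]
    exact fun y z => inner_ridge_apply_comm hR y z
  have hnx : ∀ x, ‖x‖ ≤ ‖T x‖ / σ := fun x => by
    rw [le_div_iff₀ hσ]; linarith [hT x]
  -- On the range of `T`, the vector `P y = T x` equals `S x - F x`: ridge bias on `S x`, plus the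
  -- part due to `F x`.
  have hA : ‖P - Q * P‖ ≤ 6 * α / σ ^ 2 + 2 * ‖F‖ / σ := by
    refine ContinuousLinearMap.opNorm_le_bound _ (by positivity) fun y => ?_
    have hmem : P y ∈ U := U.starProjection_apply_mem y
    obtain ⟨x, hx⟩ : ∃ x, T x = P y := by rw [hU] at hmem; exact hmem
    have hle : ‖T x‖ ≤ ‖y‖ := by rw [hx]; exact U.norm_starProjection_apply_le y
    have e : (P - Q * P) y = (S x - S (R (S x))) - (F x - Q (F x)) := by
      have : P y = S x - F x := by rw [← hx]; simp [hSdef]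
      simp only [sub_apply, mul_apply_eq_comp, this, map_sub]
      simp only [hQ, ContinuousLinearMap.comp_apply]
      abel
    have b1 := norm_sub_ridge_apply_le hα (half_pos hσ) hS hR x
    have bF : ‖F x‖ ≤ ‖F‖ * ‖x‖ := F.le_opNorm x
    have bF2 : ‖F x‖ ≤ 1 / 2 * ‖T x‖ := by
      have := F.le_of_opNorm_le hF x
      linarith [hT x]
    have b2 : ‖S x‖ ≤ 3 / 2 * ‖T x‖ := by
      have : ‖S x‖ ≤ ‖T x‖ + ‖F x‖ := norm_add_le _ _
      linarith
    have b3 : ‖F x - Q (F x)‖ ≤ 2 * ‖F‖ / σ * ‖T x‖ := by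
      calc ‖F x - Q (F x)‖ ≤ ‖F x‖ + ‖Q (F x)‖ := norm_sub_le _ _
        _ ≤ 2 * (‖F‖ * ‖x‖) := by linarith [hQle (F x)]
        _ ≤ 2 * (‖F‖ * (‖T x‖ / σ)) := by gcongr; exact hnx x
        _ = _ := by ring
    have b4 : ‖S x - S (R (S x))‖ ≤ 6 * α / σ ^ 2 * ‖T x‖ := by
      calc _ ≤ α / (σ / 2) ^ 2 * ‖S x‖ := b1
        _ ≤ α / (σ / 2) ^ 2 * (3 / 2 * ‖T x‖) := by gcongr
        _ = _ := by field_simp; ring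
    rw [e]
    calc _ ≤ ‖S x - S (R (S x))‖ + ‖F x - Q (F x)‖ := norm_sub_le _ _
      _ ≤ (6 * α / σ ^ 2 + 2 * ‖F‖ / σ) * ‖T x‖ := by linarith
      _ ≤ _ := by gcongr
  have hA' : ‖P - P * Q‖ ≤ 6 * α / σ ^ 2 + 2 * ‖F‖ / σ := by
    have : P - P * Q = star (P - Q * P) := by
      rw [star_sub, star_mul, hPsa.star_eq, hQsa.star_eq]
    rw [this]; exact (norm_star (P - Q * P)).trans_le hA
  -- Since `1 - P` kills the range of `T`, only `F` survives: `(1 - P) Q = (1 - P) F R`.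
  have hB : ‖Q - P * Q‖ ≤ 2 * ‖F‖ / σ := by
    refine ContinuousLinearMap.opNorm_le_bound _ (by positivity) fun y => ?_
    have hTU : P (T (R y)) = T (R y) := by
      rw [hP, Submodule.starProjection_eq_self_iff, hU]
      exact ⟨R y, rfl⟩
    have e : (Q - P * Q) y = Uᗮ.starProjection (F (R y)) := by
      rw [Submodule.starProjection_orthogonal']
      change (T (R y) + F (R y)) - P (T (R y) + F (R y)) = _
      rw [map_add, hTU]
      change _ = F (R y) - P (F (R y))
      abel
    rw [e]
    calc _ ≤ ‖F (R y)‖ := Submodule.norm_starProjection_apply_le _ _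
      _ ≤ ‖F‖ * ‖R y‖ := F.le_opNorm _
      _ ≤ ‖F‖ * (2 * ‖y‖ / σ) := by
        gcongr
        rw [le_div_iff₀ hσ]
        have := hS (R y)
        have := hQle y
        change ‖S (R y)‖ ≤ _ at this
        linarith
      _ = _ := by ring
  have e : P - Q = (P - P * Q) - (Q - P * Q) := by abel
  rw [e]
  calc _ ≤ ‖P - P * Q‖ + ‖Q - P * Q‖ := norm_sub_le _ _
    _ ≤ (6 * α / σ ^ 2 + 2 * ‖F‖ / σ) + 2 * ‖F‖ / σ := add_le_add hA' hB
    _ = _ := by ring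

end Perturbation

/-! ### Nets and operator norms. -/

section Nets

variable {V W : Type*} [NormedAddCommGroup V] [NormedSpace ℝ V]

/-- The ball of radius two has a `1`-net with at most `5 ^ dim` points. -/
lemma exists_net (V : Type*) [NormedAddCommGroup V] [NormedSpace ℝ V] [FiniteDimensional ℝ V] :
    ∃ s : Finset V, s.card ≤ 5 ^ Module.finrank ℝ V ∧ (∀ c ∈ s, ‖c‖ ≤ 2) ∧
      ∀ v : V, ‖v‖ ≤ 2 → ∃ c ∈ s, ‖v - c‖ ≤ 1 := by
  classical
  let p : ℕ → Prop := fun k => ∃ s : Finset V, s.card = k ∧ (∀ c ∈ s, ‖c‖ ≤ 2) ∧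
    ∀ c ∈ s, ∀ d ∈ s, c ≠ d → 1 ≤ ‖c - d‖
  have hp0 : p 0 := ⟨∅, by simp⟩
  -- A 1-separated subset of maximal cardinality is a net; the packing bound `5 ^ dim` makes the
  -- search finite.
  obtain ⟨s, hs, hs2, hsep⟩ := Nat.findGreatest_spec (P := p)
    (Nat.zero_le (5 ^ Module.finrank ℝ V)) hp0
  refine ⟨s, Besicovitch.card_le_of_separated s hs2 hsep, hs2, fun v hv => ?_⟩
  by_contra! hfar
  have hvs : v ∉ s := fun h => absurd (hfar v h) (by simp)
  have hsep' : ∀ c ∈ insert v s, ∀ d ∈ insert v s, c ≠ d → 1 ≤ ‖c - d‖ := by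
    intro c hc d hd hcd
    rcases Finset.mem_insert.1 hc with hc | hc <;> rcases Finset.mem_insert.1 hd with hd | hd
    · exact absurd (hc.trans hd.symm) hcd
    · rw [hc]; exact (hfar d hd).le
    · rw [hd, norm_sub_rev]; exact (hfar c hc).le
    · exact hsep c hc d hd hcd
  have hle2 : ∀ c ∈ insert v s, ‖c‖ ≤ 2 := by simpa [hv] using hs2
  have := Nat.le_findGreatest (P := p)
    (Besicovitch.card_le_of_separated _ hle2 hsep') ⟨_, rfl, hle2, hsep'⟩
  rw [Finset.card_insert_of_notMem hvs, hs] at this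
  omega

/-- The norm of an operator is controlled by its values on a `1`-net of the ball of radius two. -/
lemma opNorm_le_of_net [NormedAddCommGroup W] [NormedSpace ℝ W] {s : Finset V}
    (hs : ∀ v : V, ‖v‖ ≤ 2 → ∃ c ∈ s, ‖v - c‖ ≤ 1) (T : V →L[ℝ] W) {t : ℝ} (ht : 0 ≤ t)
    (h : ∀ c ∈ s, ‖T c‖ ≤ t) : ‖T‖ ≤ t := by
  -- Replacing `2 • v` by a net point costs at most `‖T‖`; halving makes the estimate
  -- self-improving.
  have key : ‖T‖ ≤ (t + ‖T‖) / 2 := by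
    refine T.opNorm_le_of_unit_norm (by positivity) fun v hv => ?_
    obtain ⟨c, hc, hcv⟩ := hs ((2 : ℝ) • v) (by simp [norm_smul, hv])
    have h1 : T ((2 : ℝ) • v) = T c + T ((2 : ℝ) • v - c) := by rw [← map_add]; congr 1; abel
    have h2 : ‖T ((2 : ℝ) • v)‖ ≤ t + ‖T‖ := by
      rw [h1]
      refine (norm_add_le _ _).trans (add_le_add (h c hc) ?_)
      exact (T.le_opNorm _).trans (mul_le_of_le_one_right (norm_nonneg _) hcv)
    rw [map_smul, norm_smul, Real.norm_ofNat] at h2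
    linarith
  linarith

open scoped RealInnerProductSpace in
/-- The norm of an operator is controlled by its bilinear form on `1`-nets of the balls of
radius two. -/
lemma opNorm_le_of_nets [NormedAddCommGroup W] [InnerProductSpace ℝ W] [FiniteDimensional ℝ W]
    {s : Finset V} {s' : Finset W} (hs : ∀ v : V, ‖v‖ ≤ 2 → ∃ c ∈ s, ‖v - c‖ ≤ 1)
    (hs' : ∀ w : W, ‖w‖ ≤ 2 → ∃ c ∈ s', ‖w - c‖ ≤ 1) (T : V →L[ℝ] W) {t : ℝ} (ht : 0 ≤ t)
    (h : ∀ c ∈ s, ∀ c' ∈ s', |⟪c', T c⟫| ≤ t) : ‖T‖ ≤ t := by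
  refine opNorm_le_of_net hs T ht fun c hc => ?_
  rw [← innerSL_apply_norm (𝕜 := ℝ) (T c)]
  refine opNorm_le_of_net hs' _ ht fun c' hc' => ?_
  rw [innerSL_apply_apply, real_inner_comm]
  exact h c hc c' hc'

end Nets

/-! ### Extreme eigenvalues and Rayleigh quotients. -/

section Spectral

variable {m : ℕ} {M : Matrix (Fin m) (Fin m) ℝ}

lemma finite_spectrum (M : Matrix (Fin m) (Fin m) ℝ) : (spectrum ℝ M).Finite :=
  Matrix.finite_real_spectrum

lemma nonempty_spectrum [NeZero m] (hM : M.IsHermitian) : (spectrum ℝ M).Nonempty := by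
  rw [hM.spectrum_real_eq_range_eigenvalues]
  exact Set.range_nonempty _

lemma rhoMin_le_rhoMax [NeZero m] (hM : M.IsHermitian) : rhoMin M ≤ rhoMax M :=
  csInf_le_csSup (nonempty_spectrum hM) (finite_spectrum M).bddBelow (finite_spectrum M).bddAbove

/-- The Rayleigh lower bound `ρ_min(M) ‖x‖² ≤ xᵀ M x`. -/
lemma rhoMin_mul_le (hM : M.IsHermitian) (x : Fin m → ℝ) :
    rhoMin M * (x ⬝ᵥ x) ≤ x ⬝ᵥ (M *ᵥ x) := by
  have h : (M - algebraMap ℝ _ (rhoMin M)).PosSemidef := by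
    rw [Matrix.posSemidef_iff_isHermitian_and_spectrum_nonneg]
    refine ⟨hM.sub (by simp [Matrix.algebraMap_eq_diagonal]), ?_⟩
    rw [← spectrum.sub_singleton_eq]
    rintro _ ⟨a, ha, b, rfl, rfl⟩
    exact sub_nonneg.2 (csInf_le (finite_spectrum M).bddBelow ha)
  have := h.dotProduct_mulVec_nonneg x
  simpa [Matrix.sub_mulVec, Algebra.algebraMap_eq_smul_one, dotProduct_sub,
    Matrix.smul_mulVec] using this

/-- The Rayleigh upper bound `xᵀ M x ≤ ρ(M) ‖x‖²`. -/
lemma le_rhoMax_mul (hM : M.IsHermitian) (x : Fin m → ℝ) :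
    x ⬝ᵥ (M *ᵥ x) ≤ rhoMax M * (x ⬝ᵥ x) := by
  have h : (algebraMap ℝ _ (rhoMax M) - M).PosSemidef := by
    rw [Matrix.posSemidef_iff_isHermitian_and_spectrum_nonneg]
    refine ⟨Matrix.IsHermitian.sub (by simp [Matrix.algebraMap_eq_diagonal]) hM, ?_⟩
    rw [← spectrum.singleton_sub_eq]
    rintro _ ⟨b, rfl, a, ha, rfl⟩
    exact sub_nonneg.2 (le_csSup (finite_spectrum M).bddAbove ha)
  have := h.dotProduct_mulVec_nonneg x
  simpa [Matrix.sub_mulVec, Algebra.algebraMap_eq_smul_one, dotProduct_sub,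
    Matrix.smul_mulVec] using this

lemma rhoMax_nonneg (hM : M.PosSemidef) : 0 ≤ rhoMax M :=
  Real.sSup_nonneg fun _ h =>
    (Matrix.posSemidef_iff_isHermitian_and_spectrum_nonneg.1 hM).2 h

/-- The infimum of a finite nonempty spectrum is an eigenvalue; `NeZero m` excludes the default
value `sInf ∅ = 0`. -/
lemma rhoMin_pos [NeZero m] (hM : M.PosDef) : 0 < rhoMin M := by
  have h := (nonempty_spectrum hM.1).csInf_mem (finite_spectrum M)
  rw [hM.1.spectrum_real_eq_range_eigenvalues] at h
  obtain ⟨i, hi⟩ := h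
  rw [rhoMin, hM.1.spectrum_real_eq_range_eigenvalues, ← hi]
  exact hM.eigenvalues_pos i

lemma one_le_cond [NeZero m] (hM : M.PosDef) : 1 ≤ cond M :=
  (one_le_div (rhoMin_pos hM)).2 (rhoMin_le_rhoMax hM.1)

end Spectral

/-! ### Matrices as operators; the deterministic bound. -/

section Operators

open scoped RealInnerProductSpace

variable {n K : ℕ}

/-- The operator `ℝᴷ → ℝⁿ` of a matrix, for the Euclidean structures. -/
noncomputable def toCLM (H : Matrix (Fin n) (Fin K) ℝ) :
    EuclideanSpace ℝ (Fin K) →L[ℝ] EuclideanSpace ℝ (Fin n) :=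
  LinearMap.toContinuousLinearMap (Matrix.toLpLin 2 2 H)

lemma ofLp_toCLM (H : Matrix (Fin n) (Fin K) ℝ) (x : EuclideanSpace ℝ (Fin K)) :
    (toCLM H x).ofLp = H *ᵥ x.ofLp := rfl

lemma toCLM_add (H E : Matrix (Fin n) (Fin K) ℝ) : toCLM (H + E) = toCLM H + toCLM E := by
  simp [toCLM]

lemma real_inner_eq_dotProduct (x y : EuclideanSpace ℝ (Fin n)) : ⟪x, y⟫ = x.ofLp ⬝ᵥ y.ofLp := by
  rw [EuclideanSpace.inner_eq_star_dotProduct, dotProduct_comm]; simp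

lemma toCLM_apply_eq_sum (H : Matrix (Fin n) (Fin K) ℝ) (x : EuclideanSpace ℝ (Fin K)) :
    toCLM H x = ∑ j, x j • WithLp.toLp 2 (H.col j) := by
  ext i
  simp [ofLp_toCLM, Matrix.mulVec, dotProduct, mul_comm]

lemma colSpan_eq_range (H : Matrix (Fin n) (Fin K) ℝ) : colSpan H = (toCLM H).range := by
  apply le_antisymm
  · refine Submodule.span_le.2 ?_
    rintro _ ⟨j, rfl⟩
    refine ⟨EuclideanSpace.single j 1, ?_⟩
    ext i
    simp [ofLp_toCLM]
  · rintro _ ⟨x, rfl⟩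
    change toCLM H x ∈ _
    rw [toCLM_apply_eq_sum]
    exact Submodule.sum_mem _ fun j _ =>
      Submodule.smul_mem _ _ (Submodule.subset_span ⟨j, rfl⟩)

lemma inner_toCLM_toCLM (H : Matrix (Fin n) (Fin K) ℝ) (x y : EuclideanSpace ℝ (Fin K)) :
    ⟪toCLM H x, toCLM H y⟫ = x.ofLp ⬝ᵥ ((Hᵀ * H) *ᵥ y.ofLp) := by
  rw [real_inner_eq_dotProduct, ofLp_toCLM, ofLp_toCLM, ← Matrix.mulVec_mulVec,
    Matrix.dotProduct_mulVec _ Hᵀ, Matrix.vecMul_transpose]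

lemma isHermitian_gram (H : Matrix (Fin n) (Fin K) ℝ) : (Hᵀ * H).IsHermitian := by
  simpa using Matrix.isHermitian_conjTranspose_mul_self H

lemma sqrt_rhoMin_mul_norm_le (H : Matrix (Fin n) (Fin K) ℝ) (x : EuclideanSpace ℝ (Fin K)) :
    √(rhoMin (Hᵀ * H)) * ‖x‖ ≤ ‖toCLM H x‖ := by
  rcases le_total (rhoMin (Hᵀ * H)) 0 with h0 | h0
  · rw [Real.sqrt_eq_zero_of_nonpos h0]; simp
  refine abs_le_of_sq_le_sq' ?_ (norm_nonneg _) |>.2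
  rw [mul_pow, Real.sq_sqrt h0, ← real_inner_self_eq_norm_sq, ← real_inner_self_eq_norm_sq,
    inner_toCLM_toCLM, real_inner_eq_dotProduct]
  exact rhoMin_mul_le (isHermitian_gram H) _

lemma posDef_gram_of_rank {H : Matrix (Fin n) (Fin K) ℝ} (hH : H.rank = K) : (Hᵀ * H).PosDef := by
  have hinj : Function.Injective H.mulVec := by
    rw [Matrix.mulVec_injective_iff, linearIndependent_iff_card_eq_finrank_span, Set.finrank,
      ← Matrix.rank_eq_finrank_span_cols, hH, Fintype.card_fin]
  simpa using Matrix.PosDef.conjTranspose_mul_self H hinj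

/-- The ridge solution operator `(Hᵀ H + α I)⁻¹ Hᵀ`. -/
noncomputable def ridgeSol (α : ℝ) (H : Matrix (Fin n) (Fin K) ℝ) :
    EuclideanSpace ℝ (Fin n) →L[ℝ] EuclideanSpace ℝ (Fin K) :=
  toCLM ((Hᵀ * H + α • (1 : Matrix (Fin K) (Fin K) ℝ))⁻¹ * Hᵀ)

lemma ridgeProj_eq_comp (α : ℝ) (H : Matrix (Fin n) (Fin K) ℝ) :
    ridgeProj α H = toCLM H ∘L ridgeSol α H := by
  ext x i
  simp only [ridgeProj, ridgeSol, ContinuousLinearMap.comp_apply, ofLp_toCLM,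
    Matrix.ofLp_toEuclideanCLM, Matrix.mulVec_mulVec, Matrix.mul_assoc]

/-- The ridge normal equations. -/
lemma ridge_normal_equations {α : ℝ} {H : Matrix (Fin n) (Fin K) ℝ}
    (hN : ∀ v, v ≠ 0 → 0 < ‖toCLM H v‖ ^ 2 + α * ‖v‖ ^ 2) (y : EuclideanSpace ℝ (Fin n))
    (v : EuclideanSpace ℝ (Fin K)) :
    ⟪toCLM H (ridgeSol α H y), toCLM H v⟫ + α * ⟪ridgeSol α H y, v⟫ = ⟪y, toCLM H v⟫ := by
  set N := Hᵀ * H + α • (1 : Matrix (Fin K) (Fin K) ℝ) with hNdef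
  -- `hN` replaces `0 < α` because α vanishes for degenerate noise; injectivity of `H` then
  -- suffices.
  have hpd : N.PosDef := by
    refine Matrix.PosDef.of_dotProduct_mulVec_pos ?_ fun x hx => ?_
    · exact (isHermitian_gram H).add (by simp [Matrix.IsHermitian])
    · have h := hN (WithLp.toLp 2 x) (by simpa using hx)
      rw [← real_inner_self_eq_norm_sq, ← real_inner_self_eq_norm_sq, inner_toCLM_toCLM,
        real_inner_eq_dotProduct] at h
      simpa [hNdef, Matrix.add_mulVec, Matrix.smul_mulVec, dotProduct_add] using h
  have hu : IsUnit N.det := hpd.det_pos.ne'.isUnit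
  have h1 : N *ᵥ (ridgeSol α H y).ofLp = Hᵀ *ᵥ y.ofLp := by
    rw [ridgeSol, ofLp_toCLM, Matrix.mulVec_mulVec, ← hNdef, Matrix.mul_nonsing_inv_cancel_left _ _ hu]
  have h2 : v.ofLp ⬝ᵥ (N *ᵥ (ridgeSol α H y).ofLp) =
      ⟪toCLM H v, toCLM H (ridgeSol α H y)⟫ + α * ⟪v, ridgeSol α H y⟫ := by
    rw [inner_toCLM_toCLM, real_inner_eq_dotProduct, hNdef]
    simp [Matrix.add_mulVec, Matrix.smul_mulVec, dotProduct_add]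
  rw [real_inner_comm, real_inner_comm v, ← h2, h1, real_inner_eq_dotProduct, ofLp_toCLM,
    Matrix.dotProduct_mulVec, Matrix.vecMul_transpose, dotProduct_comm]

/-- Deterministic error bound for the ridge-regularized projection, on the event that the
squared operator norm of the noise is at most `L s`, when `α = 2 d s`. -/
lemma norm_proj_sub_ridgeProj_sq_le {H E : Matrix (Fin n) (Fin K) ℝ} {d s L : ℝ} (hd : 0 < d)
    (hs : 0 ≤ s) (hL : 0 < L) (hr : 0 < rhoMin (Hᵀ * H)) (hE : ‖toCLM E‖ ^ 2 ≤ L * s) :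
    ‖proj H - ridgeProj (2 * d * s) (H + E)‖ ^ 2 ≤
      (72 * d ^ 2 / L + 48 * L) * (s / rhoMin (Hᵀ * H)) := by
  have hlow := sqrt_rhoMin_mul_norm_le H
  set r := rhoMin (Hᵀ * H)
  have hα : 0 ≤ 2 * d * s := by positivity
  have hσ : 0 < √r := Real.sqrt_pos.2 hr
  have hσ2 : √r ^ 2 = r := Real.sq_sqrt hr.le
  rw [proj, ridgeProj_eq_comp]
  set q := s / r with hq
  have hq0 : 0 ≤ q := by positivity
  -- The threshold is where the noise bound `L * s` equals `(√r / 2) ^ 2`.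
  rcases lt_or_ge r (4 * L * s) with hlt | hge
  · have hs' : 0 < s := by by_contra! h; nlinarith
    have h2 := norm_starProjection_sub_ridge_le_two (colSpan H) hα
      (ridge_normal_equations (α := 2 * d * s) (H := H + E) fun v hv => by
        have := norm_pos_iff.2 hv
        positivity)
    have hq1 : 1 ≤ 4 * L * q := by
      rw [hq, mul_div_assoc', one_le_div hr]; exact hlt.le
    calc _ ≤ (2 : ℝ) ^ 2 := by gcongr
      _ ≤ 48 * L * q := by linarith
      _ ≤ _ := by gcongr; linarith [show 0 ≤ 72 * d ^ 2 / L by positivity]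
  · have hE' : ‖toCLM E‖ ≤ √r / 2 := by
      refine abs_le_of_sq_le_sq' ?_ (by positivity) |>.2
      rw [div_pow, hσ2]; linarith
    have h := norm_starProjection_sub_ridge_le (colSpan H) (T := toCLM H) (F := toCLM E)
      (R := ridgeSol (2 * d * s) (H + E)) hα hσ (colSpan_eq_range H) hlow hE' (by
        rw [← toCLM_add]
        refine ridge_normal_equations fun v hv => ?_
        have hv' := norm_pos_iff.2 hv
        have h1 : toCLM (H + E) v = toCLM H v + toCLM E v := by rw [toCLM_add]; rfl
        have h2 := norm_sub_le (toCLM H v + toCLM E v) (toCLM E v)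
        have h3 := (toCLM E).le_of_opNorm_le hE' v
        have h4 : 0 < ‖toCLM (H + E) v‖ := by
          rw [h1]
          rw [add_sub_cancel_right] at h2
          have := hlow v
          have : 0 < √r * ‖v‖ := by positivity
          linarith
        positivity)
    rw [← toCLM_add] at h
    have hq4 : 4 * L * q ≤ 1 := by
      rw [hq, mul_div_assoc', div_le_one hr]; exact hge
    -- This makes the squared bias linear in `q`.
    have hqL : q ^ 2 ≤ q / (4 * L) := by
      rw [le_div_iff₀ (by positivity)]; nlinarith
    calc _ ≤ (6 * (2 * d * s) / √r ^ 2 + 4 * ‖toCLM E‖ / √r) ^ 2 := by gcongr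
      _ = (12 * d * q + 4 * ‖toCLM E‖ / √r) ^ 2 := by rw [hσ2, hq]; ring
      _ ≤ 2 * (12 * d * q) ^ 2 + 2 * (4 * ‖toCLM E‖ / √r) ^ 2 := by
        nlinarith [sq_nonneg (12 * d * q - 4 * ‖toCLM E‖ / √r)]
      _ = 288 * d ^ 2 * q ^ 2 + 32 * (‖toCLM E‖ ^ 2 / r) := by
        rw [div_pow, hσ2]; ring
      _ ≤ 288 * d ^ 2 * (q / (4 * L)) + 32 * (L * s / r) := by gcongr
      _ = (72 * d ^ 2 / L + 32 * L) * q := by rw [hq]; field_simp; ring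
      _ ≤ _ := by gcongr; norm_num

end Operators

/-! ### Sub-Gaussian tails and the norm of the noise. -/

section Noise

open scoped RealInnerProductSpace NNReal

variable {Ω : Type*} [MeasurableSpace Ω] {P : Measure Ω} {n K : ℕ}

lemma hasSubgaussianMGF_mono {X : Ω → ℝ} {c c' : ℝ≥0} (h : HasSubgaussianMGF X c P)
    (hc : c ≤ c') : HasSubgaussianMGF X c' P where
  integrable_exp_mul := h.integrable_exp_mul
  mgf_le t := (h.mgf_le t).trans (by gcongr)

/-- Two-sided sub-Gaussian tail bound, valid also for the degenerate parameter `c = 0`. -/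
lemma measureReal_sqrt_lt_abs_le [IsProbabilityMeasure P] {X : Ω → ℝ} {c : ℝ≥0}
    (h : HasSubgaussianMGF X c P) {l : ℝ} (hl : 0 ≤ l) :
    P.real {ω | √(2 * c * l) < |X ω|} ≤ 2 * Real.exp (-l) := by
  rcases eq_or_ne c 0 with rfl | hc
  · have h0 := h.ae_eq_zero_of_hasSubgaussianMGF_zero
    have : P {ω | √(2 * (0 : ℝ≥0) * l) < |X ω|} = 0 := by
      refine measure_mono_null (fun ω hω => ?_) (ae_iff.1 h0)
      intro hX
      simp [show X ω = 0 from hX] at hω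
    rw [Measure.real, this]
    simp [Real.exp_nonneg]
  · have hc' : (0 : ℝ) < c := by positivity
    -- The threshold is chosen so that the Chernoff exponent is exactly `-l`.
    have e : -√(2 * c * l) ^ 2 / (2 * c) = -l := by
      rw [Real.sq_sqrt (by positivity)]; field_simp
    have h1 := h.measure_ge_le (ε := √(2 * c * l)) (Real.sqrt_nonneg _)
    have h2 := h.neg.measure_ge_le (ε := √(2 * c * l)) (Real.sqrt_nonneg _)
    rw [e] at h1 h2
    calc _ ≤ P.real ({ω | √(2 * c * l) ≤ X ω} ∪ {ω | √(2 * c * l) ≤ (-X) ω}) := by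
          refine measureReal_mono fun ω hω => ?_
          exact (lt_abs.1 hω).imp LT.lt.le (fun h => (h.le : √(2 * c * l) ≤ -X ω))
      _ ≤ _ := measureReal_union_le _ _
      _ ≤ _ := by linarith

lemma hasSubgaussianMGF_inner_multivariateGaussian {S : Matrix (Fin n) (Fin n) ℝ}
    (hS : S.PosSemidef) (y : EuclideanSpace ℝ (Fin n)) {c : ℝ≥0}
    (hc : y.ofLp ⬝ᵥ (S *ᵥ y.ofLp) ≤ c) :
    HasSubgaussianMGF (fun z => ⟪y, z⟫) c (multivariateGaussian 0 S) := by
  have hmap := IsGaussian.map_eq_gaussianReal (μ := multivariateGaussian 0 S) (innerSL ℝ y)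
  have hmean : (multivariateGaussian 0 S)[innerSL ℝ y] = 0 := by
    rw [(innerSL ℝ y).integral_comp_id_comm IsGaussian.integrable_id]
    simp
  have hvar : Var[innerSL ℝ y; multivariateGaussian 0 S] = y.ofLp ⬝ᵥ (S *ᵥ y.ofLp) := by
    rw [← covarianceBilin_multivariateGaussian (μ := 0) hS,
      covarianceBilin_self IsGaussian.memLp_two_id]
    rfl
  rw [hmean, hvar] at hmap
  have hg : HasSubgaussianMGF id (y.ofLp ⬝ᵥ (S *ᵥ y.ofLp)).toNNReal
      ((multivariateGaussian 0 S).map (innerSL ℝ y)) := by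
    rw [hmap]
    exact ⟨fun t => integrable_exp_mul_gaussianReal t, fun t => by
      simp [mgf_id_gaussianReal]⟩
  have := (HasSubgaussianMGF.id_map_iff (by fun_prop)).1 hg
  exact hasSubgaussianMGF_mono this (Real.toNNReal_le_iff_le_coe.2 hc)

variable {E : Ω → Matrix (Fin n) (Fin K) ℝ} {γ : ℝ} {A : Matrix (Fin n) (Fin n) ℝ}

/-- The bilinear form of the noise is sub-Gaussian. -/
lemma IndependentColumns.hasSubgaussianMGF (h : IndependentColumns P E γ A)
    {x : EuclideanSpace ℝ (Fin K)} {y : EuclideanSpace ℝ (Fin n)} (hx : ‖x‖ ≤ 2) (hy : ‖y‖ ≤ 2) :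
    HasSubgaussianMGF (fun ω => ⟪y, toCLM (E ω) x⟫) (16 * (γ ^ 2 * rhoMax A)).toNNReal P := by
  have ha := rhoMax_nonneg h.posSemidef
  -- The squared radii of the two balls, 4 and 4, give the factor 16 in the variance proxy.
  have hx2 : ∑ j, x j ^ 2 ≤ 4 := by
    rw [← EuclideanSpace.real_norm_sq_eq]; nlinarith [norm_nonneg x]
  have hS : (γ ^ 2 • A).PosSemidef := h.posSemidef.smul (sq_nonneg γ)
  have hy2 : y.ofLp ⬝ᵥ ((γ ^ 2 • A) *ᵥ y.ofLp) ≤ (4 * (γ ^ 2 * rhoMax A)).toNNReal := by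
    rw [Real.coe_toNNReal _ (by positivity), Matrix.smul_mulVec, dotProduct_smul, smul_eq_mul]
    have h1 := le_rhoMax_mul h.posSemidef.1 y.ofLp
    rw [← real_inner_eq_dotProduct y y, real_inner_self_eq_norm_sq] at h1
    have h2 : ‖y‖ ^ 2 ≤ 4 := by nlinarith [norm_nonneg y]
    calc _ ≤ γ ^ 2 * (rhoMax A * ‖y‖ ^ 2) := by gcongr
      _ ≤ γ ^ 2 * (rhoMax A * 4) := by gcongr
      _ = _ := by ring
  have hcol : ∀ j, HasSubgaussianMGF (fun ω => ⟪y, noiseCol E j ω⟫)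
      (4 * (γ ^ 2 * rhoMax A)).toNNReal P := fun j => by
    have := hasSubgaussianMGF_inner_multivariateGaussian hS y hy2
    rw [← (h.law j).map_eq] at this
    exact this.of_map (h.law j).aemeasurable
  have hindep : iIndepFun (fun j ω => x j * ⟪y, noiseCol E j ω⟫) P :=
    h.indep.comp (fun j z => x j * ⟪y, z⟫) fun j => by fun_prop
  have hterm : ∀ j, HasSubgaussianMGF (fun ω => x j * ⟪y, noiseCol E j ω⟫)
      ((x j ^ 2).toNNReal * (4 * (γ ^ 2 * rhoMax A)).toNNReal) P := fun j => by
    rw [Real.toNNReal_of_nonneg (sq_nonneg (x j))]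
    exact (hcol j).const_mul (x j)
  have hsum := HasSubgaussianMGF.sum_of_iIndepFun (s := Finset.univ) hindep fun j _ => hterm j
  have e : ∀ ω, ∑ j, x j * ⟪y, noiseCol E j ω⟫ = ⟪y, toCLM (E ω) x⟫ := fun ω => by
    rw [toCLM_apply_eq_sum, inner_sum]
    simp [inner_smul_right, noiseCol]
  simp only [e] at hsum
  refine hasSubgaussianMGF_mono hsum ?_
  rw [← Finset.sum_mul, ← NNReal.coe_le_coe, NNReal.coe_mul, NNReal.coe_sum,
    Real.coe_toNNReal _ (by positivity), Real.coe_toNNReal _ (by positivity)]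
  simp only [Real.coe_toNNReal _ (sq_nonneg _)]
  calc _ ≤ 4 * (4 * (γ ^ 2 * rhoMax A)) := by gcongr
    _ = _ := by ring

/-- Operator norm bound for the noise, with probability at least `1 - δ`. -/
lemma IndependentColumns.measure_opNorm_sq_le [IsProbabilityMeasure P]
    (h : IndependentColumns P E γ A) (hn : 1 ≤ n) (hK : K ≤ n) {δ : ℝ} (hδ : δ ∈ Set.Ioo (0 : ℝ) 1) :
    ENNReal.ofReal (1 - δ) ≤ P {ω | ‖toCLM (E ω)‖ ^ 2 ≤
      32 * (4 + Real.log δ⁻¹) * (n * γ ^ 2 * rhoMax A)} := by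
  obtain ⟨hδ0, hδ1⟩ := hδ
  have ha := rhoMax_nonneg h.posSemidef
  have hlog : 0 ≤ Real.log δ⁻¹ := Real.log_nonneg ((one_le_inv₀ hδ0).2 hδ1.le)
  obtain ⟨s, hscard, hs2, hs⟩ := exists_net (EuclideanSpace ℝ (Fin K))
  obtain ⟨s', hscard', hs2', hs'⟩ := exists_net (EuclideanSpace ℝ (Fin n))
  rw [finrank_euclideanSpace_fin] at hscard hscard'
  -- There are at most 25ⁿ pairs of net points, as `K ≤ n`. The 4 absorbs them and the two-sided
  -- factor 2, since e⁴ ≥ 50; the logarithm leaves δⁿ ≤ δ.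
  set l : ℝ := n * (4 + Real.log δ⁻¹) with hl
  have hl0 : 0 ≤ l := by positivity
  set c := (16 * (γ ^ 2 * rhoMax A)).toNNReal with hc
  set B : Set Ω := ⋃ p ∈ s ×ˢ s', {ω | √(2 * c * l) < |⟪p.2, toCLM (E ω) p.1⟫|} with hB
  have hexp : (25 : ℝ) ^ n * (2 * Real.exp (-l)) ≤ δ := by
    have h1 : (50 : ℝ) ≤ Real.exp 4 := by
      have := Real.exp_one_gt_d9
      calc (50 : ℝ) ≤ 2.7182818283 ^ 4 := by norm_num
        _ ≤ Real.exp 1 ^ 4 := by gcongr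
        _ = Real.exp 4 := by rw [← Real.exp_nat_mul]; norm_num
    have h2 : Real.exp (-l) = (Real.exp 4 ^ n)⁻¹ * δ ^ n := by
      rw [hl, Real.log_inv, show -((n : ℝ) * (4 + -Real.log δ)) = -(n * 4) + n * Real.log δ by ring,
        Real.exp_add, Real.exp_neg, Real.exp_nat_mul, Real.exp_nat_mul, Real.exp_log hδ0]
    have h3 : (25 : ℝ) ^ n * 2 ≤ Real.exp 4 ^ n := by
      calc (25 : ℝ) ^ n * 2 ≤ 25 ^ n * 2 ^ n := by
            gcongr; exact le_self_pow₀ (by norm_num) (by omega)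
        _ = 50 ^ n := by rw [← mul_pow]; norm_num
        _ ≤ _ := by gcongr
    have h4 : δ ^ n ≤ δ := pow_le_of_le_one hδ0.le hδ1.le (by omega)
    calc _ = (25 : ℝ) ^ n * 2 * (Real.exp 4 ^ n)⁻¹ * δ ^ n := by rw [h2]; ring
      _ ≤ Real.exp 4 ^ n * (Real.exp 4 ^ n)⁻¹ * δ := by gcongr
      _ = δ := by rw [mul_inv_cancel₀ (by positivity), one_mul]
  have hBle : P.real B ≤ δ := by
    refine le_trans ?_ hexp
    calc P.real B ≤ ∑ p ∈ s ×ˢ s', P.real {ω | √(2 * c * l) < |⟪p.2, toCLM (E ω) p.1⟫|} :=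
          measureReal_biUnion_finset_le _ _
      _ ≤ ∑ _p ∈ s ×ˢ s', 2 * Real.exp (-l) := by
          refine Finset.sum_le_sum fun p hp => ?_
          obtain ⟨h1, h2⟩ := Finset.mem_product.1 hp
          exact measureReal_sqrt_lt_abs_le (h.hasSubgaussianMGF (hs2 _ h1) (hs2' _ h2)) hl0
      _ = (s.card * s'.card : ℝ) * (2 * Real.exp (-l)) := by
          rw [Finset.sum_const, Finset.card_product, nsmul_eq_mul]; push_cast; ring
      _ ≤ (5 ^ n * 5 ^ n) * (2 * Real.exp (-l)) := by
          gcongr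
          · calc (s.card : ℝ) ≤ 5 ^ K := by exact_mod_cast hscard
              _ ≤ 5 ^ n := by gcongr; norm_num
          · exact_mod_cast hscard'
      _ = _ := by rw [← mul_pow]; norm_num
  set G := {ω | ‖toCLM (E ω)‖ ^ 2 ≤ 32 * (4 + Real.log δ⁻¹) * (n * γ ^ 2 * rhoMax A)}
  have hcover : (Set.univ : Set Ω) ⊆ G ∪ B := by
    intro ω _
    by_contra hω
    rw [Set.mem_union, not_or] at hω
    refine hω.1 ?_
    have hnorm : ‖toCLM (E ω)‖ ≤ √(2 * c * l) := by
      refine opNorm_le_of_nets hs hs' _ (Real.sqrt_nonneg _) fun x hx y hy => ?_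
      by_contra! hlt
      exact hω.2 (Set.mem_biUnion (Finset.mem_product.2 ⟨hx, hy⟩ : (x, y) ∈ s ×ˢ s') hlt)
    calc ‖toCLM (E ω)‖ ^ 2 ≤ √(2 * c * l) ^ 2 := by gcongr
      _ = 2 * c * l := Real.sq_sqrt (by positivity)
      _ = _ := by rw [hc, Real.coe_toNNReal _ (by positivity), hl]; ring
  have h1 : 1 ≤ P.real G + P.real B := by
    rw [← probReal_univ (μ := P)]
    exact (measureReal_mono hcover).trans (measureReal_union_le _ _)
  rw [ENNReal.ofReal_le_iff_le_toReal (measure_ne_top _ _)]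
  change 1 - δ ≤ P.real G
  linarith

end Noise

end NoisyProjection

/-! ### The main theorem and its corollary. -/

theorem mainTheorem9 (δ : ℝ) (hδ : δ ∈ Set.Ioo (0 : ℝ) 1) (d : ℝ) (hd : 0 < d) :
    ∃ D : ℝ, 0 < D ∧
      ∀ {Ω : Type*} [MeasurableSpace Ω] (P : Measure Ω) [IsProbabilityMeasure P]
        (n K : ℕ) (_ : 1 ≤ K) (H : Matrix (Fin n) (Fin K) ℝ) (_ : H.rank = K)
        (γ : ℝ) (A : Matrix (Fin n) (Fin n) ℝ) (E : Ω → Matrix (Fin n) (Fin K) ℝ)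
        (_ : NoisyProjection.IndependentColumns P E γ A)
        (α : ℝ) (_ : α = 2 * d * n * γ ^ 2 * NoisyProjection.rhoMax A),
        ENNReal.ofReal (1 - δ) ≤ P {ω |
          1 / (n : ℝ) * ‖NoisyProjection.proj H - NoisyProjection.ridgeProj α (H + E ω)‖ ^ 2 ≤
              γ ^ 2 * D * max (max
                (NoisyProjection.cond (Hᵀ * H) ^ 3 *
                  (K * NoisyProjection.rhoMax A / (n * NoisyProjection.rhoMin (Hᵀ * H))))
                (NoisyProjection.cond (Hᵀ * H) ^ 3 *
                  (A.trace / (n * NoisyProjection.rhoMin (Hᵀ * H)))))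
                (NoisyProjection.rhoMax A / NoisyProjection.rhoMin (Hᵀ * H)) ∧
          ∀ C : ℝ, 1 ≤ C →
            n * NoisyProjection.rhoMax A ≤ C * max (K * NoisyProjection.rhoMax A) A.trace →
            1 / (n : ℝ) * ‖NoisyProjection.proj H - NoisyProjection.ridgeProj α (H + E ω)‖ ^ 2 ≤
              C * (γ ^ 2 * D * NoisyProjection.cond (Hᵀ * H) ^ 3 * max
                (K / n * (NoisyProjection.rhoMax A / NoisyProjection.rhoMin (Hᵀ * H)))
                (A.trace / (n * NoisyProjection.rhoMin (Hᵀ * H))))} := by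
  have hlog : 0 ≤ Real.log δ⁻¹ := Real.log_nonneg ((one_le_inv₀ hδ.1).2 hδ.2.le)
  set L : ℝ := 32 * (4 + Real.log δ⁻¹) with hLdef
  have hL : 0 < L := by positivity
  refine ⟨72 * d ^ 2 / L + 48 * L, by positivity, ?_⟩
  set D : ℝ := 72 * d ^ 2 / L + 48 * L
  have hD : 0 < D := by positivity
  intro Ω _ P _ n K hK1 H hH γ A E hE α hα
  have hKn : K ≤ n := by
    rw [← hH]; simpa using H.rank_le_height
  have hn : 1 ≤ n := hK1.trans hKn
  have hn0 : (0 : ℝ) < n := by exact_mod_cast hn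
  have : NeZero K := ⟨by omega⟩
  have hpd := NoisyProjection.posDef_gram_of_rank hH
  have hr := NoisyProjection.rhoMin_pos hpd
  have hκ := NoisyProjection.one_le_cond hpd
  have ha := NoisyProjection.rhoMax_nonneg hE.posSemidef
  refine (hE.measure_opNorm_sq_le hn hKn hδ).trans (measure_mono fun ω hω => ?_)
  have hs : 0 ≤ n * γ ^ 2 * NoisyProjection.rhoMax A := by positivity
  have hbound := NoisyProjection.norm_proj_sub_ridgeProj_sq_le hd hs hL hr hω
  rw [show 2 * d * (n * γ ^ 2 * NoisyProjection.rhoMax A) = α by rw [hα]; ring] at hbound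
  set a := NoisyProjection.rhoMax A
  set r := NoisyProjection.rhoMin (Hᵀ * H)
  set κ := NoisyProjection.cond (Hᵀ * H)
  have hmain : 1 / (n : ℝ) *
      ‖NoisyProjection.proj H - NoisyProjection.ridgeProj α (H + E ω)‖ ^ 2 ≤
      γ ^ 2 * D * (a / r) := by
    calc _ ≤ 1 / (n : ℝ) * (D * (n * γ ^ 2 * a / r)) := by gcongr
      _ = _ := by field_simp
  refine ⟨hmain.trans (by gcongr; exact le_max_right _ _), fun C hC hCa => hmain.trans ?_⟩
  have hκ3 : 1 ≤ κ ^ 3 := one_le_pow₀ hκ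
  have hmax : max (K / n * (a / r)) (A.trace / (n * r)) = max (K * a) A.trace / (n * r) := by
    rw [← max_div_div_right (show (0 : ℝ) ≤ n * r by positivity)]
    congr 1
    field_simp
  have hm0 : 0 ≤ max (K * a) A.trace := le_max_of_le_left (by positivity)
  rw [hmax]
  -- Writing `a / r` as `n * a / (n * r)` lets the hypothesis on `C` apply; `κ ^ 3 ≥ 1` is then
  -- inserted for free.
  calc γ ^ 2 * D * (a / r) = γ ^ 2 * D * 1 * (n * a / (n * r)) := by field_simp
    _ ≤ γ ^ 2 * D * κ ^ 3 * (C * max (K * a) A.trace / (n * r)) := by gcongr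
    _ = _ := by ring
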